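/- Let $n\ge 1$, $m>0$, $0\le k<m/4$, $r_0>0$, and let $\lambda=\tfrac12\bigl(1-\sqrt{1-4k/m}\bigr)\in[0,1/2)$. (These are the data of a charged particle of mass $m$ in $\mathbf R^n$ in a time-decaying harmonic potential $\tfrac12 k(t)x^2$ with $k(t)=k\,t^{-2}$ for $|t|>r_0$; the values of $k(t)$ for $|t|\le r_0$ do not enter below.) Let $V:\mathbf R\times\mathbf R^n\to\mathbf R$ be long-range, that is, $V\in C(\mathbf R;C(\mathbf R^n))$ (equivalently, $V$ is jointly continuous) and there are $0<\rho_{L}\le 1/(1-\lambda)$ and $0<C_{L}\le\tilde C_{L}$ such that $$C_{L}|x|^{-\rho_{L}}\le V(t,x)\le\tilde C_{L}|x|^{-\rho_{L}}\qquad\text{for all } t\in\mathbf R,\ |x|\ge 1 .$$ For $t,s>0$ and for $t,s<0$, let $U_{S,0}(t,s)$ and $U_S(t,s)$ be the propagators on $L^2(\mathbf R^n)$ of $$H_{0,S}(t)=\frac{p^2}{2m|t|^{2\lambda}}\quad\text{and}\quad H_S(t)=\frac{p^2}{2m|t|^{2\lambda}}+V(t,|t|^{\lambda}x),\qquad p^2=-\Delta,$$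 that is, the strongly continuous families of unitary operators with $U(s,s)=\mathrm{Id}$, $U(t,\theta)U(\theta,s)=U(t,s)$ and $i\partial_tU(t,s)=H(t)U(t,s)$, the last equation being understood as $\partial_t\langle\psi,U(t,s)\phi\rangle=-i\langle H(t)\psi,U(t,s)\phi\rangle$ for all Schwartz functions $\psi$ and all $\phi\in L^2(\mathbf R^n)$ (inner product linear in the second argument). Then neither of the reduced (unmodified) wave operators $$W_S^{\pm}=\operatorname*{s-lim}_{t\to\pm\infty}U_S(t,\pm r_0)^{*}\,U_{S,0}(t,\pm r_0)$$ exists: neither for $t\to+\infty$ nor for $t\to-\infty$ does this strong limit exist. -/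

import Mathlib

open MeasureTheory Filter Topology
open scoped SchwartzMap ComplexConjugate

noncomputable section

namespace DecayingOscillator

/-- Configuration space `ℝⁿ` with its Euclidean norm. -/
abbrev Space (n : ℕ) : Type := EuclideanSpace ℝ (Fin n)

/-- The Hilbert space `L²(ℝⁿ)` of complex-valued functions. -/
abbrev L2 (n : ℕ) : Type := Lp ℂ 2 (volume : Measure (Space n))

/-- The smaller root `λ` of `λ(λ - 1) + k/m = 0`. -/
def lam (m k : ℝ) : ℝ := (1 - Real.sqrt (1 - 4 * k / m)) / 2

/-- The reduced Hamiltonian `H_S(t) = p²/(2m|t|^{2λ}) + V(t, |t|^λ x)`, with `p² = -Δ`, evaluated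
on Schwartz functions (a core for it if `V` is bounded). -/
def reducedHamiltonian {n : ℕ} (m l : ℝ) (V : ℝ → Space n → ℝ) (t : ℝ) (ψ : 𝓢(Space n, ℂ))
    (x : Space n) : ℂ :=
  ((1 / (2 * m * |t| ^ (2 * l)) : ℝ) : ℂ) * (-(Laplacian.laplacian ψ : 𝓢(Space n, ℂ)) x)
    + ((V t (|t| ^ l • x) : ℝ) : ℂ) * ψ x

/-- The reduced free Hamiltonian `H_{0,S}(t) = p²/(2m|t|^{2λ})`. -/
def reducedFreeHamiltonian {n : ℕ} (m l : ℝ) (t : ℝ) (ψ : 𝓢(Space n, ℂ)) (x : Space n) : ℂ :=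
  ((1 / (2 * m * |t| ^ (2 * l)) : ℝ) : ℂ) * (-(Laplacian.laplacian ψ : 𝓢(Space n, ℂ)) x)

/-- `U(t,s)`, `t, s ∈ J`, is a propagator for the (symmetric) operators `H(t)` on the time
interval `J`: a strongly continuous family of unitary operators on `L²(ℝⁿ)` with `U(s,s) = Id`,
`U(t,θ)U(θ,s) = U(t,s)` and `i ∂ₜ U(t,s) = H(t) U(t,s)`. The evolution equation is tested against
Schwartz functions: `∂ₜ ⟨ψ, U(t,s)φ⟩ = -i ⟨H(t)ψ, U(t,s)φ⟩`, which does not require that `U(t,s)`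
preserve the domain of `H(t)`. The equation `i ∂ₛ U(t,s) = -U(t,s) H(s)` follows from
`U(t,s) = U(s,t)*`. -/
structure IsPropagatorOn {n : ℕ} (J : Set ℝ) (H : ℝ → 𝓢(Space n, ℂ) → Space n → ℂ)
    (U : ℝ → ℝ → L2 n →L[ℂ] L2 n) : Prop where
  mem_unitary : ∀ t ∈ J, ∀ s ∈ J, U t s ∈ unitary (L2 n →L[ℂ] L2 n)
  self_eq_one : ∀ s ∈ J, U s s = 1
  comp_eq : ∀ t ∈ J, ∀ θ ∈ J, ∀ s ∈ J, (U t θ).comp (U θ s) = U t s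
  strongly_continuous : ∀ φ : L2 n, ContinuousOn (fun q : ℝ × ℝ => U q.1 q.2 φ) (J ×ˢ J)
  evolution : ∀ s ∈ J, ∀ t ∈ J, ∀ (ψ : 𝓢(Space n, ℂ)) (φ : L2 n),
    HasDerivWithinAt (fun τ : ℝ => inner ℂ (ψ.toLp 2 volume) (U τ s φ))
      (-Complex.I * ∫ x, conj (H t ψ x) * (U t s φ : Space n → ℂ) x) J t

/-- `V` belongs to the long-range class: `V ∈ C(ℝ; C(ℝⁿ))`, i.e. `V` is jointly continuous, and
`C |x|^{-ρ} ≤ V(t,x) ≤ C' |x|^{-ρ}` for `|x| ≥ 1`, with `0 < ρ ≤ 1/(1-λ)` and `0 < C ≤ C'`. -/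
def IsLongRange {n : ℕ} (l : ℝ) (V : ℝ → Space n → ℝ) : Prop :=
  Continuous (fun q : ℝ × Space n => V q.1 q.2) ∧
    ∃ ρ C C' : ℝ, 0 < ρ ∧ ρ ≤ 1 / (1 - l) ∧ 0 < C ∧ C ≤ C' ∧
      ∀ (t : ℝ) (x : Space n), 1 ≤ ‖x‖ → C * ‖x‖ ^ (-ρ) ≤ V t x ∧ V t x ≤ C' * ‖x‖ ^ (-ρ)

/-- `W` is the strong limit of `U(t,r)* U₀(t,r)` as `t` tends along the filter `F`. -/
def IsWaveOperator {n : ℕ} (F : Filter ℝ) (r : ℝ) (U U₀ : ℝ → ℝ → L2 n →L[ℂ] L2 n)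
    (W : L2 n →L[ℂ] L2 n) : Prop :=
  ∀ φ : L2 n, Tendsto (fun t : ℝ => ContinuousLinearMap.adjoint (U t r) (U₀ t r φ)) F (𝓝 (W φ))

end DecayingOscillator

end

noncomputable section

namespace DecayingOscillator

/-! ### Nonexistence criterion in an abstract Hilbert space -/

section AbstractCook

variable {E : Type*} [NormedAddCommGroup E] [InnerProductSpace ℂ E] [CompleteSpace E]

/-! The argument is Cook's method run backwards. In the effective time `τ = freeTime m l t` the
reduced free evolution is the Schrödinger flow, and an explicit `packet` supported in `τ ≤ ‖x‖ ≤ 2τ`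
solves it up to a defect of size `τ⁻²`. In the variable `t` the defect is of order `t ^ (-(2 -
2λ))`, integrable because `λ < 1/2`, so the packet `Ψ` is asymptotic to a true free orbit `U₀(t)φ`
(`exists_tendsto_adjoint_apply`). If `W` existed, then `U(t)Wφ - Ψ(t) → 0`.

On the support of the packet the potential is comparable to `t ^ (-σ)` with `σ = (1 - λ)ρ ≤ 1`
(`IsLongRange.exists_bounds`). Hence, after a constant phase, the real part of `⟨Ψ, U(t)Wφ⟩` has
derivative at least a positive multiple of `1/t`, up to an integrable error. It would grow like `log
t`, yet it is bounded by Cauchy-Schwarz; this is `not_tendsto_adjoint_comp`.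

Negative times reduce to positive ones by `t ↦ -t`, which replaces `i` by `-i`; the sign `ε = ±1`
treats both cases at once. -/

theorem norm_apply_of_mem_unitary {A : E →L[ℂ] E} (hA : A ∈ unitary (E →L[ℂ] E)) (x : E) :
    ‖A x‖ = ‖x‖ :=
  ContinuousLinearMap.norm_map_of_mem_unitary hA x

theorem apply_adjoint_of_mem_unitary {A : E →L[ℂ] E} (hA : A ∈ unitary (E →L[ℂ] E)) (x : E) :
    A (ContinuousLinearMap.adjoint A x) = x := by
  have h := Unitary.mul_star_self_of_mem hA
  exact congrArg (fun B : E →L[ℂ] E => B x) h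

theorem hasDerivAt_rpow_one_sub_div {p : ℝ} (hp : 1 < p) {t : ℝ} (ht : 0 < t) :
    HasDerivAt (fun s : ℝ => s ^ (1 - p) / (p - 1)) (-t ^ (-p)) t := by
  have h := (Real.hasDerivAt_rpow_const (x := t) (p := 1 - p) (Or.inl ht.ne')).div_const (p - 1)
  have h0 : p - 1 ≠ 0 := by linarith
  rw [show -t ^ (-p) = (1 - p) * t ^ (1 - p - 1) / (p - 1) by
    rw [show 1 - p - 1 = -p by ring]; field_simp; ring]
  exact h

theorem tendsto_rpow_one_sub_div {p : ℝ} (hp : 1 < p) :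
    Tendsto (fun s : ℝ => s ^ (1 - p) / (p - 1)) atTop (𝓝 0) := by
  have h := (tendsto_rpow_neg_atTop (y := p - 1) (by linarith)).div_const (p - 1)
  simpa using h

/-- A vector curve whose evolution along the unitary family `A` has an integrable defect `e`
is asymptotic to an orbit of `A`. -/
theorem exists_tendsto_adjoint_apply {T B p : ℝ} (hT : 0 < T) (hp : 1 < p) (hB : 0 ≤ B)
    {A : ℝ → E →L[ℂ] E} (hA : ∀ t, 0 < t → A t ∈ unitary (E →L[ℂ] E)) {Ψ e : ℝ → E}
    (hd : ∀ t, T ≤ t → ∀ η, HasDerivAt (fun τ => inner ℂ (Ψ τ) (A τ η)) (inner ℂ (e t) (A t η)) t)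
    (he : ∀ t, T ≤ t → ‖e t‖ ≤ B * t ^ (-p)) :
    ∃ φ, Tendsto (fun t => ContinuousLinearMap.adjoint (A t) (Ψ t)) atTop (𝓝 φ) := by
  set a : ℝ → E := fun t => ContinuousLinearMap.adjoint (A t) (Ψ t) with ha
  -- The tail integral of `r ^ (-p)` over `r > s`, finite because `1 < p`.
  set b : ℝ → ℝ := fun s => s ^ (1 - p) / (p - 1) with hb
  have hb0 : ∀ s, 0 < s → 0 ≤ b s := fun s hs =>
    div_nonneg (Real.rpow_nonneg hs.le _) (by linarith)
  have key : ∀ s t, T ≤ s → s ≤ t → ‖a t - a s‖ ≤ B * b s := by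
    intro s t hs hst
    -- Only pairings with a fixed `η` are known to be differentiable, so the bound is proved weakly,
    -- uniformly in `η`, and then applied to `η = a t - a s`.
    have hη : ∀ η, ‖inner ℂ (a t - a s) η‖ ≤ B * b s * ‖η‖ := by
      intro η
      have hin : ∀ r, inner ℂ (a r) η = inner ℂ (Ψ r) (A r η) := fun r => by
        rw [ha]; exact ContinuousLinearMap.adjoint_inner_left _ _ _
      have hf : ∀ r, T ≤ r → HasDerivAt (fun τ => inner ℂ (Ψ τ) (A τ η) - inner ℂ (Ψ s) (A s η))
          (inner ℂ (e r) (A r η)) r := fun r hr => (hd r hr η).sub_const _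
      have hB' : ∀ r, HasDerivAt (fun τ => B * (b s - b τ) * ‖η‖) (B * r ^ (-p) * ‖η‖) r ∨ r < T := by
        intro r
        rcases lt_or_ge r T with h | h
        · exact Or.inr h
        · left
          have := (((hasDerivAt_rpow_one_sub_div hp (hT.trans_le h)).const_sub (b s)).const_mul
            B).mul_const ‖η‖
          simpa using this
      have := image_norm_le_of_norm_deriv_right_le_deriv_boundary' (a := s) (b := t)
        (f := fun τ => inner ℂ (Ψ τ) (A τ η) - inner ℂ (Ψ s) (A s η))
        (f' := fun r => inner ℂ (e r) (A r η))
        (B := fun τ => B * (b s - b τ) * ‖η‖) (B' := fun r => B * r ^ (-p) * ‖η‖)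
        (fun r hr => (hf r (hs.trans hr.1)).continuousAt.continuousWithinAt)
        (fun r hr => (hf r (hs.trans hr.1)).hasDerivWithinAt) (by simp)
        (fun r hr => ((hB' r).resolve_right
          (not_lt.2 (hs.trans hr.1))).continuousAt.continuousWithinAt)
        (fun r hr => ((hB' r).resolve_right (not_lt.2 (hs.trans hr.1))).hasDerivWithinAt)
        (fun r hr => by
          refine (norm_inner_le_norm _ _).trans ?_
          rw [norm_apply_of_mem_unitary (hA r (hT.trans_le (hs.trans hr.1)))]
          exact mul_le_mul_of_nonneg_right (he r (hs.trans hr.1)) (norm_nonneg _))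
        (Set.right_mem_Icc.2 hst)
      rw [inner_sub_left, hin, hin]
      refine this.trans ?_
      have h1 := hb0 t (by linarith)
      exact mul_le_mul_of_nonneg_right
        (mul_le_mul_of_nonneg_left (by linarith) hB) (norm_nonneg _)
    have h1 := hη (a t - a s)
    rw [inner_self_eq_norm_sq_to_K] at h1
    simp only [Complex.coe_algebraMap, norm_pow, Complex.norm_real, norm_norm] at h1
    rcases (norm_nonneg (a t - a s)).eq_or_lt with h0 | h0
    · rw [← h0]; exact mul_nonneg hB (hb0 s (by linarith))
    · rw [sq] at h1
      exact le_of_mul_le_mul_right h1 h0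
  have hc : CauchySeq a := by
    rw [Metric.cauchySeq_iff']
    intro ε hε
    have h0 : Tendsto (fun s => B * b s) atTop (𝓝 0) := by
      simpa using (tendsto_rpow_one_sub_div hp).const_mul B
    obtain ⟨N, hN1, hN2⟩ := ((h0.eventually (gt_mem_nhds hε)).and (eventually_ge_atTop T)).exists
    exact ⟨N, fun t ht => by rw [dist_eq_norm]; exact (key N t hN2 ht).trans_lt hN1⟩
  exact cauchySeq_tendsto_of_complete hc

/-- If an approximate solution `Ψ` of the free evolution `A₀` feels a perturbation `v` whose
expectation in the state `Ψ` decays no faster than `1 / t`, the wave operator does not exist. -/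
theorem not_tendsto_adjoint_comp {T B p c C₁ C₂ : ℝ} (hT : 0 < T) (hp : 1 < p) (hB : 0 ≤ B)
    (hC₁ : 0 < C₁) (hC₂ : 0 < C₂)
    {A₀ A : ℝ → E →L[ℂ] E} (hA₀ : ∀ t, 0 < t → A₀ t ∈ unitary (E →L[ℂ] E))
    (hA : ∀ t, 0 < t → A t ∈ unitary (E →L[ℂ] E)) {Ψ e v : ℝ → E} {w : ℝ → ℝ} {μ : ℂ}
    (hμ : ‖μ‖ = 1)
    (hd₀ : ∀ t, T ≤ t → ∀ η,
      HasDerivAt (fun τ => inner ℂ (Ψ τ) (A₀ τ η)) (inner ℂ (e t) (A₀ t η)) t)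
    (hd : ∀ t, T ≤ t → ∀ η, HasDerivAt (fun τ => inner ℂ (Ψ τ) (A τ η))
      (inner ℂ (e t) (A t η) + μ * inner ℂ (v t) (A t η)) t)
    (he : ∀ t, T ≤ t → ‖e t‖ ≤ B * t ^ (-p)) (hΨ : ∀ t, T ≤ t → ‖Ψ t‖ ≤ c)
    (hw : ∀ t, T ≤ t → t⁻¹ ≤ w t) (hv : ∀ t, T ≤ t → ‖v t‖ ≤ C₂ * w t)
    (hvΨ : ∀ t, T ≤ t → C₁ * w t ≤ (inner ℂ (v t) (Ψ t) : ℂ).re) :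
    ¬ ∃ W : E →L[ℂ] E, ∀ φ, Tendsto (fun t => ContinuousLinearMap.adjoint (A t) (A₀ t φ)) atTop
      (𝓝 (W φ)) := by
  rintro ⟨W, hW⟩
  obtain ⟨φ, hφ⟩ := exists_tendsto_adjoint_apply hT hp hB hA₀ hd₀ he
  set η := W φ
  -- Unitarity of `A t` and `A₀ t` turns the two limits, of the wave operator and of the free
  -- asymptotics of `Ψ`, into `A t η - A₀ t φ → 0` and `Ψ t - A₀ t φ → 0`.
  have hlim : Tendsto (fun t => ‖A t η - Ψ t‖) atTop (𝓝 0) := by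
    have h1 : Tendsto (fun t => ‖ContinuousLinearMap.adjoint (A t) (A₀ t φ) - η‖
        + ‖ContinuousLinearMap.adjoint (A₀ t) (Ψ t) - φ‖) atTop (𝓝 0) := by
      simpa using (tendsto_iff_norm_sub_tendsto_zero.1 (hW φ)).add
        (tendsto_iff_norm_sub_tendsto_zero.1 hφ)
    refine squeeze_zero' (Eventually.of_forall fun t => norm_nonneg _) ?_ h1
    filter_upwards [eventually_gt_atTop 0] with t ht
    rw [← norm_apply_of_mem_unitary (hA t ht) (ContinuousLinearMap.adjoint (A t) (A₀ t φ) - η),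
      ← norm_apply_of_mem_unitary (hA₀ t ht) (ContinuousLinearMap.adjoint (A₀ t) (Ψ t) - φ),
      map_sub, map_sub, apply_adjoint_of_mem_unitary (hA t ht),
      apply_adjoint_of_mem_unitary (hA₀ t ht), ← norm_neg (A₀ t φ - A t η),
      ← norm_neg (Ψ t - A₀ t φ)]
    refine le_trans (le_of_eq ?_) (norm_add_le _ _)
    congr 1; abel
  -- With this threshold, replacing `Ψ t` by `A t η` in the expectation costs at most half of the
  -- lower bound `C₁ * w t`.
  obtain ⟨S, hS⟩ := eventually_atTop.1 ((hlim.eventually (gt_mem_nhds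
    (show (0 : ℝ) < C₁ / (2 * C₂) by positivity))).and (eventually_ge_atTop T))
  -- The factor `conj μ` cancels `μ`, so that the perturbation enters the derivative through the
  -- real part of `⟨v, A η⟩`.
  set G : ℝ → ℝ := fun t => (conj μ * inner ℂ (Ψ t) (A t η)).re with hG
  have hGd : ∀ t, T ≤ t → HasDerivAt G
      ((conj μ * inner ℂ (e t) (A t η)).re + (inner ℂ (v t) (A t η) : ℂ).re) t := by
    intro t ht
    have h := ((hd t ht η).const_mul (conj μ))
    have h2 := Complex.reCLM.hasFDerivAt.comp_hasDerivAt t h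
    have h3 : conj μ * μ = 1 := by
      rw [mul_comm, Complex.mul_conj, Complex.normSq_eq_norm_sq, hμ]; simp
    rw [← Complex.add_re, ← one_mul (inner ℂ (v t) (A t η)), ← h3, mul_assoc, ← mul_add]
    exact h2
  -- `G` minus its guaranteed logarithmic growth; the tail term absorbs the defect `e`, which makes
  -- `K` nondecreasing.
  set K : ℝ → ℝ := fun t => G t - (C₁ / 2 * Real.log t + B * ‖η‖ * (t ^ (1 - p) / (p - 1)))
  have hKd : ∀ t, S ≤ t → ∃ d, 0 ≤ d ∧ HasDerivAt K d t := by
    intro t ht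
    obtain ⟨h1, hTt⟩ := hS t ht
    have ht0 : 0 < t := hT.trans_le hTt
    refine ⟨_, ?_, (hGd t hTt).sub (((Real.hasDerivAt_log ht0.ne').const_mul (C₁ / 2)).add
      ((hasDerivAt_rpow_one_sub_div hp ht0).const_mul (B * ‖η‖)))⟩
    have h2 : -(B * t ^ (-p) * ‖η‖) ≤ (conj μ * inner ℂ (e t) (A t η)).re := by
      refine neg_le_of_abs_le ((Complex.abs_re_le_norm _).trans ?_)
      rw [norm_mul, RCLike.norm_conj, hμ, one_mul]
      refine (norm_inner_le_norm _ _).trans ?_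
      rw [norm_apply_of_mem_unitary (hA t ht0)]
      exact mul_le_mul_of_nonneg_right (he t hTt) (norm_nonneg _)
    have hw0 : 0 < w t := (inv_pos.2 ht0).trans_le (hw t hTt)
    have h3 : -(C₁ / 2 * w t) ≤ (inner ℂ (v t) (A t η - Ψ t) : ℂ).re := by
      refine neg_le_of_abs_le ((Complex.abs_re_le_norm _).trans ((norm_inner_le_norm _ _).trans ?_))
      refine (mul_le_mul (hv t hTt) h1.le (norm_nonneg _) (by positivity)).trans (le_of_eq ?_)
      field_simp
    have h4 : (inner ℂ (v t) (A t η) : ℂ).re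
        = (inner ℂ (v t) (Ψ t) : ℂ).re + (inner ℂ (v t) (A t η - Ψ t) : ℂ).re := by
      rw [inner_sub_right, Complex.sub_re]; ring
    have h5 := hvΨ t hTt
    have h6 : C₁ / 2 * t⁻¹ ≤ C₁ / 2 * w t := mul_le_mul_of_nonneg_left (hw t hTt) (by positivity)
    rw [h4]
    linarith
  have hmono : MonotoneOn K (Set.Ici S) := by
    refine monotoneOn_of_deriv_nonneg (convex_Ici S) ?_ ?_ ?_
    · intro t ht
      obtain ⟨d, -, hd⟩ := hKd t ht
      exact hd.continuousAt.continuousWithinAt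
    · intro t ht
      rw [interior_Ici] at ht
      obtain ⟨d, -, hd⟩ := hKd t (le_of_lt ht)
      exact hd.differentiableAt.differentiableWithinAt
    · intro t ht
      rw [interior_Ici] at ht
      obtain ⟨d, hd0, hd⟩ := hKd t (le_of_lt ht)
      rw [hd.deriv]; exact hd0
  have hlog : Tendsto (fun t => C₁ / 2 * Real.log t) atTop atTop :=
    Real.tendsto_log_atTop.const_mul_atTop (by positivity)
  obtain ⟨t, ht1, ht2⟩ := ((hlog.eventually_gt_atTop (c * ‖η‖ - K S)).and
    (eventually_ge_atTop S)).exists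
  have hTt := (hS t ht2).2
  have ht0 : 0 < t := hT.trans_le hTt
  have h1 := hmono (Set.mem_Ici.2 le_rfl) (Set.mem_Ici.2 ht2) ht2
  have h2 : G t ≤ c * ‖η‖ := by
    refine (Complex.re_le_norm _).trans ?_
    rw [norm_mul, RCLike.norm_conj, hμ, one_mul]
    refine (norm_inner_le_norm _ _).trans ?_
    rw [norm_apply_of_mem_unitary (hA t ht0)]
    exact mul_le_mul_of_nonneg_right (hΨ t hTt) (norm_nonneg _)
  have h3 : 0 ≤ B * ‖η‖ * (t ^ (1 - p) / (p - 1)) :=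
    mul_nonneg (mul_nonneg hB (norm_nonneg _))
      (div_nonneg (Real.rpow_nonneg ht0.le _) (by linarith))
  have h4 : K t = G t - (C₁ / 2 * Real.log t + B * ‖η‖ * (t ^ (1 - p) / (p - 1))) := rfl
  linarith

end AbstractCook

/-! ### Calculus in `L²` and radial Laplacians -/

section ProductRule

variable {E : Type*} [NormedAddCommGroup E] [InnerProductSpace ℂ E]

/-- Product rule for the inner product of a differentiable curve with a weakly differentiable one. -/
theorem hasDerivAt_inner_of_weak {P x : ℝ → E} {P' : E} {d : ℂ} {t : ℝ} (hP : HasDerivAt P P' t)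
    (hx : ContinuousAt x t) (hd : HasDerivAt (fun τ => (inner ℂ (P t) (x τ) : ℂ)) d t) :
    HasDerivAt (fun τ => (inner ℂ (P τ) (x τ) : ℂ)) (inner ℂ P' (x t) + d) t := by
  -- Freezing `P` at `t` separates the two sources of variation: the slope of `P` converges in norm,
  -- so here `x` needs only continuity.
  have h1 : HasDerivAt (fun τ => (inner ℂ (P τ - P t) (x τ) : ℂ)) (inner ℂ P' (x t)) t := by
    rw [hasDerivAt_iff_tendsto_slope] at hP ⊢
    refine (hP.inner (hx.tendsto.mono_left nhdsWithin_le_nhds)).congr fun τ => ?_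
    simp only [slope, vsub_eq_sub, sub_self, inner_zero_left, sub_zero]
    rw [← Complex.coe_smul ((τ - t)⁻¹) (P τ - P t), inner_smul_left, Complex.conj_ofReal,
      Complex.real_smul]
  refine (h1.add hd).congr_of_eventuallyEq (Eventually.of_forall fun τ => ?_)
  simp

end ProductRule

variable {n : ℕ}

/-- The constant depends on `K` alone, so uniform bounds on a common support become `L²` bounds. It
is kept positive, even for null `K`, so that it can be divided by. -/
theorem norm_toLp_le_of_bound {K : Set (Space n)} (hK : IsCompact K) :
    ∃ C : ℝ, 0 < C ∧ ∀ (f : 𝓢(Space n, ℂ)) (M : ℝ), 0 ≤ M → (∀ x ∈ K, ‖f x‖ ≤ M) →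
      (∀ x, x ∉ K → f x = 0) → ‖f.toLp 2 volume‖ ≤ C * M := by
  have hfin : volume K ≠ ⊤ := hK.measure_lt_top.ne
  refine ⟨(volume K ^ (2⁻¹ : ℝ)).toReal + 1, by positivity, fun f M hM hf h0 => ?_⟩
  rw [SchwartzMap.norm_toLp, ← eLpNorm_restrict_eq_of_support_subset (s := K)
    (Function.support_subset_iff'.2 h0)]
  have h1 : eLpNorm f 2 (volume.restrict K) ≤ volume K ^ (2⁻¹ : ℝ) * ENNReal.ofReal M := by
    have := eLpNorm_le_of_ae_bound (p := 2) (μ := volume.restrict K) (f := f) (C := M)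
      ((ae_restrict_iff' hK.measurableSet).2 (Eventually.of_forall hf))
    simpa using this
  have h2 : volume K ^ (2⁻¹ : ℝ) ≠ ⊤ := ENNReal.rpow_ne_top_of_nonneg (by norm_num) hfin
  refine (ENNReal.toReal_mono (ENNReal.mul_ne_top h2 ENNReal.ofReal_ne_top) h1).trans ?_
  rw [ENNReal.toReal_mul, ENNReal.toReal_ofReal hM]
  exact mul_le_mul_of_nonneg_right (by linarith) hM

/-- A pointwise differentiable curve of Schwartz functions with locally constant compact support and
continuous derivative is differentiable in `L²`. -/
theorem hasDerivAt_toLp {Ψ D : ℝ → 𝓢(Space n, ℂ)} {t₀ : ℝ} {K : Set (Space n)} (hK : IsCompact K)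
    (hs : ∀ᶠ t in 𝓝 t₀, ∀ x, x ∉ K → Ψ t x = 0)
    (hd : ∀ᶠ t in 𝓝 t₀, ∀ x, HasDerivAt (fun s => Ψ s x) (D t x) t)
    (hc : ∀ x ∈ K, ContinuousAt (fun q : ℝ × Space n => D q.1 q.2) (t₀, x)) :
    HasDerivAt (fun t => (Ψ t).toLp 2 volume) ((D t₀).toLp 2 volume) t₀ := by
  obtain ⟨C, hC0, hC⟩ := norm_toLp_le_of_bound hK
  rw [hasDerivAt_iff_isLittleO, Asymptotics.isLittleO_iff]
  intro ε hε
  -- Compactness of `K` makes the continuity of `D` in time uniform in `x`; the mean value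
  -- inequality in time then gives a uniform remainder estimate.
  have hcont : ∀ᶠ t in 𝓝 t₀, ∀ x ∈ K, ‖D t x - D t₀ x‖ < ε / C := by
    refine hK.eventually_forall_of_forall_eventually fun x hx => ?_
    have h1 : ContinuousAt (fun q : ℝ × Space n => ‖D q.1 q.2 - D t₀ q.2‖) (t₀, x) :=
      ((hc x hx).sub ((D t₀).continuous.comp continuous_snd).continuousAt).norm
    refine h1.eventually (gt_mem_nhds ?_)
    simp only [sub_self, norm_zero]
    positivity
  obtain ⟨δ, hδ, hball⟩ := Metric.eventually_nhds_iff_ball.1 ((hs.and hd).and hcont)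
  filter_upwards [Metric.ball_mem_nhds t₀ hδ] with t ht
  have ht₀ : t₀ ∈ Metric.ball t₀ δ := Metric.mem_ball_self hδ
  have hoff : ∀ x, x ∉ K → D t₀ x = 0 := by
    intro x hx
    refine ((hball t₀ ht₀).1.2 x).unique ((hasDerivAt_const t₀ (0 : ℂ)).congr_of_eventuallyEq ?_)
    filter_upwards [hs] with s hs using hs x hx
  have hb := hC (Ψ t - Ψ t₀ - (t - t₀) • D t₀) (ε / C * ‖t - t₀‖) (by positivity)
    (fun x hx => by
      have := (convex_ball t₀ δ).norm_image_sub_le_of_norm_hasDerivWithin_le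
        (f := fun s => Ψ s x - s • D t₀ x) (f' := fun s => D s x - D t₀ x) (C := ε / C)
        (fun s hs => (((hball s hs).1.2 x).sub (by
          simpa using (hasDerivAt_id s).smul_const (D t₀ x))).hasDerivWithinAt)
        (fun s hs => ((hball s hs).2 x hx).le) ht₀ ht
      refine le_trans (le_of_eq ?_) this
      congr 1
      simp only [sub_apply, smul_apply, sub_smul]
      abel)
    (fun x hx => by
      simp [(hball t ht).1.1 x hx, (hball t₀ ht₀).1.1 x hx, hoff x hx])
  have heq : (Ψ t - Ψ t₀ - (t - t₀) • D t₀).toLp 2 volume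
      = (Ψ t).toLp 2 volume - (Ψ t₀).toLp 2 volume - (t - t₀) • (D t₀).toLp 2 volume := by
    have h := fun f : 𝓢(Space n, ℂ) => SchwartzMap.toLpCLM_apply (𝕜 := ℝ) (p := 2) (f := f)
      (μ := (volume : Measure (Space n)))
    rw [← h, ← h, ← h, ← h, map_sub, map_sub, map_smul]
  rw [heq] at hb
  refine hb.trans (le_of_eq ?_)
  field_simp

/-- The Laplacian of a radial Schwartz function `x ↦ f (‖x‖ ^ 2)`. -/
theorem laplacian_radial {f f₁ f₂ : ℝ → ℂ} (h₁ : ∀ u, HasDerivAt f (f₁ u) u)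
    (h₂ : ∀ u, HasDerivAt f₁ (f₂ u) u) (ψ : 𝓢(Space n, ℂ)) (hψ : ∀ x, ψ x = f (‖x‖ ^ 2))
    (x : Space n) :
    (Laplacian.laplacian ψ : 𝓢(Space n, ℂ)) x
      = 4 * ((‖x‖ ^ 2 : ℝ) : ℂ) * f₂ (‖x‖ ^ 2) + 2 * (n : ℂ) * f₁ (‖x‖ ^ 2) := by
  have hsq : ∀ x v : Space n, HasDerivAt (fun t : ℝ => ‖x + t • v‖ ^ 2) (2 * inner ℝ x v) 0 := by
    intro x v
    have h := (((hasDerivAt_id (0 : ℝ)).smul_const v).const_add x).norm_sq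
    simpa using h
  have hline : ∀ (g g' : ℝ → ℂ), (∀ u, HasDerivAt g (g' u) u) → ∀ x v : Space n,
      HasDerivAt (fun t : ℝ => g (‖x + t • v‖ ^ 2)) ((2 * inner ℝ x v : ℝ) * g' (‖x‖ ^ 2)) 0 := by
    intro g g' hg x v
    have h := HasDerivAt.scomp (h := fun t : ℝ => ‖x + t • v‖ ^ 2) (g₁ := g) (0 : ℝ)
      (by simpa using hg (‖x‖ ^ 2)) (hsq x v)
    rw [Complex.real_smul] at h
    exact h
  have hfirst : ∀ (v x : Space n), LineDeriv.lineDerivOp v ψ x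
      = (2 * inner ℝ x v : ℝ) * f₁ (‖x‖ ^ 2) := by
    intro v x
    rw [SchwartzMap.lineDerivOp_apply, lineDeriv]
    simp only [hψ]
    exact (hline f f₁ h₁ x v).deriv
  -- The square of `inner ℝ x v` is written as a product in this order to match Parseval's identity
  -- in the sum over the basis.
  have hsecond : ∀ (v x : Space n), LineDeriv.lineDerivOp v (LineDeriv.lineDerivOp v ψ) x
      = (2 * ‖v‖ ^ 2 : ℝ) * f₁ (‖x‖ ^ 2)
        + 4 * ((inner ℝ x v * inner ℝ v x : ℝ) : ℂ) * f₂ (‖x‖ ^ 2) := by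
    intro v x
    rw [SchwartzMap.lineDerivOp_apply, lineDeriv]
    simp only [hfirst]
    have ha : HasDerivAt (fun t : ℝ => ((2 * inner ℝ (x + t • v) v : ℝ) : ℂ))
        ((2 * ‖v‖ ^ 2 : ℝ) : ℂ) 0 := by
      have h := ((((hasDerivAt_id (0 : ℝ)).smul_const v).const_add x).inner ℝ
        (hasDerivAt_const (0 : ℝ) v)).const_mul 2
      have := h.ofReal_comp
      simpa using this
    have := (ha.mul (hline f₁ f₂ h₂ x v)).deriv
    rw [← Pi.mul_def, this, real_inner_comm x v]
    simp
    ring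
  rw [SchwartzMap.laplacian_eq_sum (EuclideanSpace.basisFun (Fin n) ℝ), sum_apply]
  simp only [hsecond]
  rw [Finset.sum_add_distrib, ← Finset.sum_mul, ← Finset.sum_mul, ← Finset.mul_sum,
    ← Complex.ofReal_sum, ← Complex.ofReal_sum, (EuclideanSpace.basisFun (Fin n) ℝ).sum_inner_mul_inner x x,
    real_inner_self_eq_norm_sq]
  simp
  ring

/-- The `L²` pairing of a square integrable function with an element of `L²`. -/
theorem integral_conj_mul_eq_inner {f : Space n → ℂ} (hf : MemLp f 2 volume) (φ : L2 n) :
    ∫ x, conj (f x) * (φ : Space n → ℂ) x = inner ℂ (hf.toLp f) φ := by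
  rw [L2.inner_def]
  refine integral_congr_ae ?_
  filter_upwards [hf.coeFn_toLp] with x hx
  rw [hx, RCLike.inner_apply, mul_comm]

/-! ### Profiles and approximate free packets -/

/-- Smooth functions on the half line supported in `[1, 3]`, used as radial momentum profiles. -/
structure Profile where
  toFun : ℝ → ℂ
  contDiff : ContDiff ℝ ((⊤ : ℕ∞) : WithTop ℕ∞) toFun
  eq_zero : ∀ v, v ∉ Set.Icc (1 : ℝ) 3 → toFun v = 0

namespace Profile

/-- The derivative of a profile. -/
def deriv (q : Profile) : Profile where
  toFun := _root_.deriv q.toFun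
  contDiff := (contDiff_infty_iff_deriv.1 q.contDiff).2
  eq_zero v hv := by
    have h : q.toFun =ᶠ[𝓝 v] fun _ => 0 := by
      filter_upwards [isClosed_Icc.isOpen_compl.mem_nhds hv] with w hw using q.eq_zero w hw
    rw [h.deriv_eq, deriv_const]

/-- The product of a profile with a smooth function. -/
def mul (a : ℝ → ℂ) (ha : ContDiff ℝ ((⊤ : ℕ∞) : WithTop ℕ∞) a) (q : Profile) : Profile where
  toFun v := a v * q.toFun v
  contDiff := ha.mul q.contDiff
  eq_zero v hv := by rw [q.eq_zero v hv, mul_zero]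

/-- The profile `-iε (2 v q'' + n q')` of the defect of a packet with profile `q`. -/
def defect (n : ℕ) (ε : ℝ) (q : Profile) : Profile where
  toFun v := -Complex.I * ε * (2 * (v : ℂ) * q.deriv.deriv.toFun v + n * q.deriv.toFun v)
  contDiff := by
    have h1 := q.deriv.contDiff
    have h2 := q.deriv.deriv.contDiff
    have h3 : ContDiff ℝ ((⊤ : ℕ∞) : WithTop ℕ∞) (fun v : ℝ => (v : ℂ)) :=
      Complex.ofRealCLM.contDiff
    fun_prop
  eq_zero v hv := by
    rw [q.deriv.eq_zero v hv, q.deriv.deriv.eq_zero v hv]; simp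

theorem hasDerivAt (q : Profile) (v : ℝ) : HasDerivAt q.toFun (q.deriv.toFun v) v :=
  (q.contDiff.differentiable (by simp) v).hasDerivAt

/-- A profile with value one at `2`. -/
def bump : Profile where
  toFun v := ((⟨1 / 2, 1, by norm_num, by norm_num⟩ : ContDiffBump (2 : ℝ)) v : ℂ)
  contDiff := Complex.ofRealCLM.contDiff.comp (ContDiffBump.contDiff _)
  eq_zero v hv := by
    rw [Complex.ofReal_eq_zero]
    refine ContDiffBump.zero_of_le_dist _ ?_
    rw [Real.dist_eq]
    by_contra h
    rw [not_le, abs_lt] at h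
    exact hv ⟨by linarith, by linarith⟩

theorem bump_two : bump.toFun 2 = 1 := by
  have h : (⟨1 / 2, 1, by norm_num, by norm_num⟩ : ContDiffBump (2 : ℝ)) 2 = 1 :=
    ContDiffBump.one_of_mem_closedBall _ (Metric.mem_closedBall_self (by norm_num))
  simp only [bump, h, Complex.ofReal_one]

end Profile

/-- The factor `τ ^ (-n/2) exp(iεu/(2τ))` of a free packet, as a function of `u = ‖x‖²`. -/
def carrier (n : ℕ) (ε τ u : ℝ) : ℂ :=
  ((τ ^ (-(n : ℝ) / 2) : ℝ) : ℂ) * Complex.exp (Complex.I * ε / (2 * τ) * u)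

/-- The profile lives on `[1, 3]`, which gives `‖x‖ ≤ √3 |τ|`, relaxed to `2 |τ|`. At `τ = 0` the
quotient is `0`, outside the profile's support. -/
theorem sq_norm_mem_of_ne_zero {q : Profile} {τ : ℝ} {x : Space n} (h : q.toFun (‖x‖ ^ 2 / τ ^ 2) ≠ 0) :
    |τ| ≤ ‖x‖ ∧ ‖x‖ ≤ 2 * |τ| := by
  obtain ⟨h1, h2⟩ := not_not.1 (mt (q.eq_zero (‖x‖ ^ 2 / τ ^ 2)) h)
  have hτ : 0 < τ ^ 2 := by
    rcases (sq_nonneg τ).eq_or_lt with h0 | h0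
    · rw [← h0, div_zero] at h1; linarith
    · exact h0
  rw [le_div_iff₀ hτ] at h1
  rw [div_le_iff₀ hτ] at h2
  constructor
  · exact abs_le_of_sq_le_sq (by linarith) (norm_nonneg _)
  · refine le_of_sq_le_sq ?_ (by positivity)
    rw [mul_pow, sq_abs]; linarith

/-- The packet `τ ^ (-n/2) exp(iε‖x‖²/(2τ)) q(‖x‖²/τ²)`: asymptotically, a free wave whose
momentum distribution is `x ↦ q(‖x‖²)`. -/
def packet (n : ℕ) (ε : ℝ) (q : Profile) (τ : ℝ) : 𝓢(Space n, ℂ) :=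
  HasCompactSupport.toSchwartzMap
    (f := fun x : Space n => carrier n ε τ (‖x‖ ^ 2) * q.toFun (‖x‖ ^ 2 / τ ^ 2))
    (HasCompactSupport.intro (isCompact_closedBall (0 : Space n) (2 * |τ|)) fun x hx => by
      by_contra h
      exact hx (mem_closedBall_zero_iff.2 (sq_norm_mem_of_ne_zero (right_ne_zero_of_mul h)).2))
    (by
      have h3 : ContDiff ℝ ((⊤ : ℕ∞) : WithTop ℕ∞) (fun v : ℝ => (v : ℂ)) :=
        Complex.ofRealCLM.contDiff
      have h1 : ContDiff ℝ ((⊤ : ℕ∞) : WithTop ℕ∞) (carrier n ε τ) := by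
        unfold carrier
        exact contDiff_const.mul (contDiff_const.mul h3).cexp
      exact (h1.comp (contDiff_norm_sq ℝ)).mul
        (q.contDiff.comp ((contDiff_norm_sq ℝ).div_const _)))

theorem packet_apply (ε : ℝ) (q : Profile) (τ : ℝ) (x : Space n) :
    packet n ε q τ x = carrier n ε τ (‖x‖ ^ 2) * q.toFun (‖x‖ ^ 2 / τ ^ 2) := rfl

theorem packet_support {ε : ℝ} {q : Profile} {τ : ℝ} {x : Space n} (h : packet n ε q τ x ≠ 0) :
    |τ| ≤ ‖x‖ ∧ ‖x‖ ≤ 2 * |τ| :=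
  sq_norm_mem_of_ne_zero (right_ne_zero_of_mul h)

theorem norm_carrier (ε : ℝ) {τ : ℝ} (hτ : 0 < τ) (u : ℝ) :
    ‖carrier n ε τ u‖ = τ ^ (-(n : ℝ) / 2) := by
  have h : Complex.I * ε / (2 * τ) * u = ((ε / (2 * τ) * u : ℝ) : ℂ) * Complex.I := by
    push_cast; ring
  rw [carrier, norm_mul, h, Complex.norm_exp_ofReal_mul_I, mul_one, Complex.norm_real,
    Real.norm_of_nonneg (Real.rpow_nonneg hτ.le _)]

/-- The `L²` norm of a packet does not depend on time. -/
theorem norm_toLp_packet (ε : ℝ) (q : Profile) {τ : ℝ} (hτ : 0 < τ) :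
    ‖(packet n ε q τ).toLp 2 volume‖ = ‖(packet n ε q 1).toLp 2 volume‖ := by
  have key : ∀ {τ : ℝ}, 0 < τ →
      ∫ x, ‖packet n ε q τ x‖ ^ (2 : ℝ) = ∫ x : Space n, ‖q.toFun (‖x‖ ^ 2)‖ ^ 2 := by
    intro τ hτ
    -- The phase has modulus one, and `τ ^ (-n/2)` is the normalisation that makes the dilation by
    -- `τ` unitary.
    have h1 : ∀ x : Space n, ‖packet n ε q τ x‖ ^ (2 : ℝ)
        = (τ ^ n)⁻¹ * ‖q.toFun (‖τ⁻¹ • x‖ ^ 2)‖ ^ 2 := by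
      intro x
      rw [packet_apply, Real.rpow_two, norm_mul, norm_carrier ε hτ, mul_pow, ← Real.rpow_natCast,
        ← Real.rpow_mul hτ.le, norm_smul, norm_inv, Real.norm_of_nonneg hτ.le,
        show -(n : ℝ) / 2 * ((2 : ℕ) : ℝ) = -n by push_cast; ring, Real.rpow_neg hτ.le,
        Real.rpow_natCast, mul_pow, inv_pow, inv_mul_eq_div (τ ^ 2)]
    simp only [h1]
    rw [integral_const_mul, Measure.integral_comp_inv_smul_of_nonneg volume
      (fun y : Space n => ‖q.toFun (‖y‖ ^ 2)‖ ^ 2) hτ.le, finrank_euclideanSpace_fin, smul_eq_mul,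
      inv_mul_cancel_left₀ (pow_ne_zero _ hτ.ne')]
  rw [SchwartzMap.norm_toLp' (by norm_num) (by norm_num),
    SchwartzMap.norm_toLp' (by norm_num) (by norm_num)]
  simp only [ENNReal.toReal_ofNat]
  rw [key hτ, key one_pos]

/-- A continuous function vanishing almost everywhere vanishes identically, but this packet is
nonzero where `‖x‖ ^ 2 = 2`. Such a point exists since `1 ≤ n`. -/
theorem norm_toLp_packet_bump_pos (hn : 1 ≤ n) (ε : ℝ) :
    0 < ‖(packet n ε Profile.bump 1).toLp 2 volume‖ := by
  rw [norm_pos_iff]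
  intro h
  have h1 : (packet n ε Profile.bump 1 : Space n → ℂ) =ᵐ[volume] fun _ => 0 :=
    (SchwartzMap.coeFn_toLp _ 2 volume).symm.trans (by rw [h]; exact Lp.coeFn_zero _ _ _)
  have h2 := (Continuous.ae_eq_iff_eq volume (SchwartzMap.continuous _) continuous_const).1 h1
  have h3 := congrFun h2 (EuclideanSpace.single (⟨0, hn⟩ : Fin n) (Real.sqrt 2))
  rw [packet_apply] at h3
  simp only [PiLp.norm_single, sq_abs, one_pow, div_one,
    Real.norm_eq_abs, Real.sq_sqrt (show (0 : ℝ) ≤ 2 by norm_num), Profile.bump_two, mul_one] at h3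
  have h4 := norm_carrier (n := n) ε one_pos 2
  rw [h3] at h4
  simp at h4

/-- The time derivative of a packet. -/
def packetDeriv (n : ℕ) (ε : ℝ) (q : Profile) (τ : ℝ) : 𝓢(Space n, ℂ) :=
  -- The terms come from the amplitude, the phase and the profile; each is a multiple of a packet,
  -- hence Schwartz.
  (-(n / (2 * τ)) : ℂ) • packet n ε q τ
    - (Complex.I * ε / 2) • packet n ε (q.mul (fun v => (v : ℂ)) Complex.ofRealCLM.contDiff) τ
    - (2 / τ : ℂ) • packet n ε (q.deriv.mul (fun v => (v : ℂ)) Complex.ofRealCLM.contDiff) τ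

theorem packetDeriv_apply (ε : ℝ) (q : Profile) (τ : ℝ) (x : Space n) :
    packetDeriv n ε q τ x = carrier n ε τ (‖x‖ ^ 2) * (-(n / (2 * τ)) * q.toFun (‖x‖ ^ 2 / τ ^ 2)
      - Complex.I * ε / 2 * (((‖x‖ ^ 2 / τ ^ 2 : ℝ) : ℂ) * q.toFun (‖x‖ ^ 2 / τ ^ 2))
      - 2 / τ * (((‖x‖ ^ 2 / τ ^ 2 : ℝ) : ℂ) * q.deriv.toFun (‖x‖ ^ 2 / τ ^ 2))) := by
  simp only [packetDeriv, sub_apply, smul_apply, packet_apply, Profile.mul, smul_eq_mul]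
  ring

theorem hasDerivAt_carrier (ε : ℝ) {τ : ℝ} (hτ : 0 < τ) (u : ℝ) :
    HasDerivAt (fun s => carrier n ε s u)
      (carrier n ε τ u * (-(n / (2 * τ)) - Complex.I * ε / 2 * (u / τ ^ 2))) τ := by
  have hτ' : (τ : ℂ) ≠ 0 := Complex.ofReal_ne_zero.2 hτ.ne'
  have h1 := (Real.hasDerivAt_rpow_const (x := τ) (p := -(n : ℝ) / 2) (Or.inl hτ.ne')).ofReal_comp
  have h2 : HasDerivAt (fun s : ℝ => Complex.I * ε / (2 * (s : ℂ)) * u)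
      (-(Complex.I * ε / 2 * (u / τ ^ 2))) τ := by
    have h : HasDerivAt (fun s : ℝ => Complex.I * ε / 2 * u * (s : ℂ)⁻¹)
        (Complex.I * ε / 2 * u * (-1 / (τ : ℂ) ^ 2)) τ :=
      ((Complex.ofRealCLM.hasDerivAt (x := τ)).inv hτ').const_mul (Complex.I * ε / 2 * u)
    have hfun : (fun s : ℝ => Complex.I * ε / (2 * (s : ℂ)) * u)
        = fun s : ℝ => Complex.I * ε / 2 * u * (s : ℂ)⁻¹ := by
      ext s; ring
    rw [hfun]
    exact h.congr_deriv (by ring)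
  have h3 := h1.mul h2.cexp
  refine h3.congr_deriv ?_
  rw [carrier, Real.rpow_sub_one hτ.ne']
  push_cast
  field_simp
  ring

theorem hasDerivAt_packet (ε : ℝ) (q : Profile) {τ : ℝ} (hτ : 0 < τ) (x : Space n) :
    HasDerivAt (fun s => packet n ε q s x) (packetDeriv n ε q τ x) τ := by
  have h2 : HasDerivAt (fun s : ℝ => ‖x‖ ^ 2 / s ^ 2) (-2 * ‖x‖ ^ 2 / τ ^ 3) τ := by
    have h : HasDerivAt (fun s : ℝ => ‖x‖ ^ 2 * (s ^ 2)⁻¹)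
        (‖x‖ ^ 2 * (-(2 * τ) / (τ ^ 2) ^ 2)) τ := by
      have := ((hasDerivAt_pow 2 τ).inv (pow_ne_zero _ hτ.ne')).const_mul (‖x‖ ^ 2)
      simpa using this
    simp only [div_eq_mul_inv] at h ⊢
    refine h.congr_deriv ?_
    field_simp
  have h3 := (q.hasDerivAt _).scomp τ h2
  have h4 := (hasDerivAt_carrier (n := n) ε hτ (‖x‖ ^ 2)).mul h3
  refine h4.congr_deriv ?_
  have hτ' : (τ : ℂ) ≠ 0 := Complex.ofReal_ne_zero.2 hτ.ne'
  rw [packetDeriv_apply, Complex.real_smul]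
  simp only [Function.comp_apply]
  push_cast
  field_simp
  ring

theorem continuousAt_packetDeriv (ε : ℝ) (q : Profile) {τ : ℝ} (hτ : 0 < τ) (x : Space n) :
    ContinuousAt (fun p : ℝ × Space n => packetDeriv n ε q p.1 p.2) (τ, x) := by
  have hτ' : (τ : ℂ) ≠ 0 := Complex.ofReal_ne_zero.2 hτ.ne'
  have h1 : ContinuousAt (fun p : ℝ × Space n => p.1) (τ, x) := continuousAt_fst
  have hC : ContinuousAt (fun p : ℝ × Space n => (p.1 : ℂ)) (τ, x) :=
    Complex.continuous_ofReal.continuousAt.comp h1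
  have h2 : ContinuousAt (fun p : ℝ × Space n => ‖p.2‖ ^ 2) (τ, x) := by fun_prop
  have h3 : ContinuousAt (fun p : ℝ × Space n => ‖p.2‖ ^ 2 / p.1 ^ 2) (τ, x) :=
    h2.div (h1.pow 2) (pow_ne_zero _ hτ.ne')
  have h3' : ContinuousAt (fun p : ℝ × Space n => ((‖p.2‖ ^ 2 / p.1 ^ 2 : ℝ) : ℂ)) (τ, x) :=
    Complex.continuous_ofReal.continuousAt.comp h3
  have h2' : ContinuousAt (fun p : ℝ × Space n => ((‖p.2‖ ^ 2 : ℝ) : ℂ)) (τ, x) :=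
    Complex.continuous_ofReal.continuousAt.comp h2
  have hq : ∀ r : Profile, ContinuousAt
      (fun p : ℝ × Space n => r.toFun (‖p.2‖ ^ 2 / p.1 ^ 2)) (τ, x) := fun r =>
    ContinuousAt.comp (g := r.toFun) (r.contDiff.continuous.continuousAt) h3
  have h4 : ContinuousAt (fun p : ℝ × Space n => carrier n ε p.1 (‖p.2‖ ^ 2)) (τ, x) := by
    unfold carrier
    refine ContinuousAt.mul ?_ ?_
    · exact Complex.continuous_ofReal.continuousAt.comp (h1.rpow_const (Or.inl hτ.ne'))
    · refine Complex.continuous_exp.continuousAt.comp (ContinuousAt.mul ?_ h2')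
      exact continuousAt_const.div (continuousAt_const.mul hC) (mul_ne_zero two_ne_zero hτ')
  simp only [packetDeriv_apply]
  refine h4.mul (((ContinuousAt.mul ?_ (hq q)).sub (continuousAt_const.mul (h3'.mul (hq q)))).sub
    (ContinuousAt.mul ?_ (h3'.mul (hq q.deriv))))
  · exact (continuousAt_const.div (continuousAt_const.mul hC) (mul_ne_zero two_ne_zero hτ')).neg
  · exact continuousAt_const.div hC hτ'

theorem hasDerivAt_toLp_packet (ε : ℝ) (q : Profile) {τ : ℝ} (hτ : 0 < τ) :
    HasDerivAt (fun s => (packet n ε q s).toLp 2 volume)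
      ((packetDeriv n ε q τ).toLp 2 volume) τ := by
  refine hasDerivAt_toLp (D := packetDeriv n ε q)
    (isCompact_closedBall (0 : Space n) (2 * (2 * τ))) ?_ ?_
    (fun x _ => continuousAt_packetDeriv ε q hτ x)
  · filter_upwards [lt_mem_nhds hτ, gt_mem_nhds (show τ < 2 * τ by linarith)] with s hs hs' x hx
    by_contra h
    refine hx (mem_closedBall_zero_iff.2 ((packet_support h).2.trans ?_))
    rw [abs_of_pos hs]; linarith
  · filter_upwards [lt_mem_nhds hτ] with s hs x using hasDerivAt_packet ε q hs x

/-- A packet solves the free equation `∂_τ ψ = (iε/2) Δψ` up to a defect of order `τ⁻²`. -/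
theorem packetDeriv_sub_laplacian {ε : ℝ} (hε : ε ^ 2 = 1) (q : Profile) {τ : ℝ} (hτ : 0 < τ)
    (x : Space n) :
    packetDeriv n ε q τ x
        - Complex.I * ε / 2 * (Laplacian.laplacian (packet n ε q τ) : 𝓢(Space n, ℂ)) x
      = ((τ ^ 2)⁻¹ : ℂ) * packet n ε (q.defect n ε) τ x := by
  have hτ' : (τ : ℂ) ≠ 0 := Complex.ofReal_ne_zero.2 hτ.ne'
  have hε' : (ε : ℂ) ^ 2 = 1 := by exact_mod_cast hε
  have hcar : ∀ u : ℝ, HasDerivAt (carrier n ε τ)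
      (carrier n ε τ u * (Complex.I * ε / (2 * τ))) u := by
    intro u
    have h := (((Complex.ofRealCLM.hasDerivAt (x := u)).const_mul
      (Complex.I * ε / (2 * τ))).cexp).const_mul ((τ ^ (-(n : ℝ) / 2) : ℝ) : ℂ)
    refine h.congr_deriv ?_
    simp only [Complex.ofRealCLM_apply, carrier]
    simp
    ring
  have hq : ∀ (r : Profile) (u : ℝ), HasDerivAt (fun s => r.toFun (s / τ ^ 2))
      (((τ : ℂ) ^ 2)⁻¹ * r.deriv.toFun (u / τ ^ 2)) u := by
    intro r u
    have h := (r.hasDerivAt (u / τ ^ 2)).scomp u ((hasDerivAt_id u).div_const (τ ^ 2))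
    refine h.congr_deriv ?_
    rw [Complex.real_smul]; push_cast; ring
  have h₁ : ∀ u : ℝ, HasDerivAt (fun s => carrier n ε τ s * q.toFun (s / τ ^ 2))
      (carrier n ε τ u * (Complex.I * ε / (2 * τ) * q.toFun (u / τ ^ 2)
        + ((τ : ℂ) ^ 2)⁻¹ * q.deriv.toFun (u / τ ^ 2))) u := by
    intro u
    refine ((hcar u).mul (hq q u)).congr_deriv ?_
    ring
  have h₂ : ∀ u : ℝ, HasDerivAt (fun s => carrier n ε τ s *
      (Complex.I * ε / (2 * τ) * q.toFun (s / τ ^ 2)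
        + ((τ : ℂ) ^ 2)⁻¹ * q.deriv.toFun (s / τ ^ 2)))
      (carrier n ε τ u * ((Complex.I * ε / (2 * τ)) ^ 2 * q.toFun (u / τ ^ 2)
        + 2 * (Complex.I * ε / (2 * τ)) * (((τ : ℂ) ^ 2)⁻¹ * q.deriv.toFun (u / τ ^ 2))
        + (((τ : ℂ) ^ 2)⁻¹) ^ 2 * q.deriv.deriv.toFun (u / τ ^ 2))) u := by
    intro u
    refine ((hcar u).mul (((hq q u).const_mul _).add
      ((hq q.deriv u).const_mul ((τ : ℂ) ^ 2)⁻¹))).congr_deriv ?_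
    simp only [Pi.add_apply]
    ring
  -- The time derivative cancels every Laplacian term in which the phase is differentiated; what
  -- survives is `4 v q'' + 2 n q'` over `τ ^ 2`, times `-iε/2`, where `v` is the argument of the
  -- profile.
  rw [laplacian_radial h₁ h₂ (packet n ε q τ) (packet_apply ε q τ) x, packetDeriv_apply,
    packet_apply]
  simp only [Profile.defect]
  generalize carrier n ε τ (‖x‖ ^ 2) = c
  generalize q.deriv.deriv.toFun (‖x‖ ^ 2 / τ ^ 2) = q₂
  generalize q.deriv.toFun (‖x‖ ^ 2 / τ ^ 2) = q₁
  generalize q.toFun (‖x‖ ^ 2 / τ ^ 2) = q₀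
  have hI : Complex.I ^ 2 = -1 := Complex.I_sq
  push_cast
  generalize ((‖x‖ : ℝ) : ℂ) = X
  field_simp
  ring_nf
  simp only [show Complex.I ^ 3 = -Complex.I from Complex.I_pow_three, hI, hε',
    show (ε : ℂ) ^ 3 = ε by rw [pow_succ, hε', one_mul]]
  ring

/-! ### Effective time, size of the potential, and the defect -/

theorem lam_lt_half {m k : ℝ} (hm : 0 < m) (hk : k < m / 4) : lam m k < 1 / 2 := by
  have h : 0 < Real.sqrt (1 - 4 * k / m) := by
    rw [Real.sqrt_pos, sub_pos, div_lt_one hm]; linarith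
  unfold lam; linarith

/-- The effective time `∫ t^(-2l) dt / m` of the reduced free evolution. -/
def freeTime (m l t : ℝ) : ℝ := 1 / (m * (1 - 2 * l)) * t ^ (1 - 2 * l)

theorem freeTime_pos {m l t : ℝ} (hm : 0 < m) (hl : l < 1 / 2) (ht : 0 < t) :
    0 < freeTime m l t := by
  have : 0 < 1 - 2 * l := by linarith
  unfold freeTime; positivity

theorem hasDerivAt_freeTime {m l t : ℝ} (hm : 0 < m) (hl : l < 1 / 2) (ht : 0 < t) :
    HasDerivAt (freeTime m l) (t ^ (-(2 * l)) / m) t := by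
  have h0 : 1 - 2 * l ≠ 0 := by linarith
  have h := (Real.hasDerivAt_rpow_const (x := t) (p := 1 - 2 * l) (Or.inl ht.ne')).const_mul
    (1 / (m * (1 - 2 * l)))
  refine h.congr_deriv ?_
  rw [show 1 - 2 * l - 1 = -(2 * l) by ring]
  field_simp

/-- Along the region swept out by a packet, a long-range potential decays exactly like a power
`t ^ (-σ)` with `σ ≤ 1`. -/
theorem IsLongRange.exists_bounds {m l : ℝ} (hm : 0 < m) (hl : l < 1 / 2) {V : ℝ → Space n → ℝ}
    (hV : IsLongRange l V) :
    ∃ T a b σ : ℝ, 1 ≤ T ∧ 0 < a ∧ 0 < b ∧ σ ≤ 1 ∧ ∀ t, T ≤ t → ∀ x : Space n,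
      freeTime m l t ≤ ‖x‖ → ‖x‖ ≤ 2 * freeTime m l t →
        a * t ^ (-σ) ≤ V t (|t| ^ l • x) ∧ V t (|t| ^ l • x) ≤ b * t ^ (-σ) := by
  obtain ⟨-, ρ, C, C', hρ, hρl, hC, hCC', hVb⟩ := hV
  have hl' : 0 < 1 - 2 * l := by linarith
  have hl'' : 0 < 1 - l := by linarith
  set κ : ℝ := 1 / (m * (1 - 2 * l)) with hκ
  have hκ0 : 0 < κ := by positivity
  -- Past `T` the rescaled point `|t| ^ l • x` has norm at least one, where the decay bounds on `V`
  -- apply.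
  obtain ⟨T, hT⟩ := eventually_atTop.1
    (((tendsto_rpow_atTop hl'').const_mul_atTop hκ0).eventually_ge_atTop 1)
  have hC' : 0 < C' := hC.trans_le hCC'
  refine ⟨max 1 T, C * (2 * κ) ^ (-ρ), C' * κ ^ (-ρ), (1 - l) * ρ, le_max_left _ _, by positivity,
    by positivity, ?_, fun t ht x hx₁ hx₂ => ?_⟩
  -- The condition `ρ ≤ 1 / (1 - l)` says exactly that the time decay rate is at most one.
  · rwa [mul_comm, ← le_div_iff₀ hl'']
  have ht1 : 1 ≤ t := (le_max_left _ _).trans ht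
  have ht0 : 0 < t := by linarith
  have hR := hT t ((le_max_right _ _).trans ht)
  have hscale : t ^ l * freeTime m l t = κ * t ^ (1 - l) := by
    rw [freeTime, mul_left_comm, ← Real.rpow_add ht0, show l + (1 - 2 * l) = 1 - l by ring]
  have hnorm : ‖|t| ^ l • x‖ = t ^ l * ‖x‖ := by
    rw [norm_smul, abs_of_pos ht0, Real.norm_of_nonneg (Real.rpow_nonneg ht0.le _)]
  have htl : 0 < t ^ l := Real.rpow_pos_of_pos ht0 _
  have hlow : κ * t ^ (1 - l) ≤ ‖|t| ^ l • x‖ := by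
    rw [hnorm, ← hscale]; exact mul_le_mul_of_nonneg_left hx₁ htl.le
  have hupp : ‖|t| ^ l • x‖ ≤ 2 * κ * t ^ (1 - l) := by
    rw [hnorm, mul_assoc, ← hscale, mul_left_comm]; exact mul_le_mul_of_nonneg_left hx₂ htl.le
  obtain ⟨h1, h2⟩ := hVb t _ (hR.trans hlow)
  have hpow : ∀ c : ℝ, 0 < c → (c * t ^ (1 - l)) ^ (-ρ) = c ^ (-ρ) * t ^ (-((1 - l) * ρ)) := by
    intro c hc
    rw [Real.mul_rpow hc.le (Real.rpow_nonneg ht0.le _), ← Real.rpow_mul ht0.le, mul_neg]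
  constructor
  · refine le_trans ?_ h1
    rw [mul_assoc, ← hpow _ (by positivity)]
    exact mul_le_mul_of_nonneg_left (Real.rpow_le_rpow_of_nonpos (by linarith) hupp
      (by linarith)) hC.le
  · refine h2.trans ?_
    rw [mul_assoc, ← hpow _ hκ0]
    exact mul_le_mul_of_nonneg_left (Real.rpow_le_rpow_of_nonpos (by linarith) hlow
      (by linarith)) hC'.le

/-- The reduced free Hamiltonian as a map on Schwartz functions. -/
def freeHamiltonianSchwartz (m l t : ℝ) (ψ : 𝓢(Space n, ℂ)) : 𝓢(Space n, ℂ) :=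
  ((1 / (2 * m * |t| ^ (2 * l)) : ℝ) : ℂ) • (-Laplacian.laplacian ψ)

theorem freeHamiltonianSchwartz_coe (m l t : ℝ) (ψ : 𝓢(Space n, ℂ)) :
    ⇑(freeHamiltonianSchwartz m l t ψ) = reducedFreeHamiltonian m l t ψ := rfl

theorem toLp_add (f g : 𝓢(Space n, ℂ)) :
    (f + g).toLp 2 volume = f.toLp 2 volume + g.toLp 2 volume :=
  map_add (SchwartzMap.toLpCLM ℂ ℂ 2 (volume : Measure (Space n))) f g

theorem toLp_smul (c : ℂ) (f : 𝓢(Space n, ℂ)) :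
    (c • f).toLp 2 volume = c • f.toLp 2 volume :=
  map_smul (SchwartzMap.toLpCLM ℂ ℂ 2 (volume : Measure (Space n))) c f

/-- The defect of a packet with respect to the reduced free evolution. -/
def freeDefect (n : ℕ) (m l ε : ℝ) (q : Profile) (t : ℝ) : 𝓢(Space n, ℂ) :=
  ((t ^ (-(2 * l)) / m * ((freeTime m l t) ^ 2)⁻¹ : ℝ) : ℂ) •
    packet n ε (q.defect n ε) (freeTime m l t)

/-- The derivative `t ^ (-(2 * l)) / m` of the effective time is twice the coefficient of `-Δ`, so
the chain rule transports the packet's defect from `τ` to `t`. -/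
theorem freeDefect_eq {m l ε t : ℝ} (hm : 0 < m) (hl : l < 1 / 2) (hε : ε ^ 2 = 1) (ht : 0 < t)
    (q : Profile) :
    ((t ^ (-(2 * l)) / m : ℝ) : ℂ) • packetDeriv n ε q (freeTime m l t)
      + (Complex.I * ε) • freeHamiltonianSchwartz m l t (packet n ε q (freeTime m l t))
      = freeDefect n m l ε q t := by
  ext x
  have h := packetDeriv_sub_laplacian hε q (freeTime_pos hm hl ht) x
  have hc : (1 / (2 * m * |t| ^ (2 * l)) : ℝ) = t ^ (-(2 * l)) / m / 2 := by
    rw [abs_of_pos ht, Real.rpow_neg ht.le]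
    field_simp
  simp only [freeDefect, freeHamiltonianSchwartz, add_apply, smul_apply, neg_apply, smul_eq_mul, hc]
  push_cast
  rw [mul_assoc (_ / _ : ℂ), ← h]
  ring

/-- The exponents add up as `-2l - 2(1 - 2l) = -(2 - 2l)`, which is below `-1` exactly when `l <
1/2`. -/
theorem norm_freeDefect {m l ε t : ℝ} (hm : 0 < m) (hl : l < 1 / 2) (ht : 0 < t) (q : Profile) :
    ‖(freeDefect n m l ε q t).toLp 2 volume‖
      = m * (1 - 2 * l) ^ 2 * ‖(packet n ε (q.defect n ε) 1).toLp 2 volume‖ * t ^ (-(2 - 2 * l)) := by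
  have hl' : 0 < 1 - 2 * l := by linarith
  have hτ := freeTime_pos hm hl ht
  rw [freeDefect, toLp_smul, norm_smul, norm_toLp_packet _ _ hτ, Complex.norm_real,
    Real.norm_of_nonneg (by positivity)]
  have h1 : (freeTime m l t ^ 2)⁻¹ = (m * (1 - 2 * l)) ^ 2 * t ^ (-(2 * (1 - 2 * l))) := by
    rw [freeTime, mul_pow, ← Real.rpow_natCast (t ^ (1 - 2 * l)), ← Real.rpow_mul ht.le, mul_inv,
      ← Real.rpow_neg ht.le, div_pow, one_pow, one_div, inv_inv]
    congr 2; push_cast; ring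
  have h2 : t ^ (-(2 - 2 * l)) = t ^ (-(2 * l)) * t ^ (-(2 * (1 - 2 * l))) := by
    rw [← Real.rpow_add ht]; congr 1; ring
  rw [h1, h2]
  field_simp

theorem re_inner_nonneg_of_ae {f g : L2 n}
    (h : ∀ᵐ x, 0 ≤ (inner ℂ ((f : Space n → ℂ) x) ((g : Space n → ℂ) x) : ℂ).re) :
    0 ≤ (inner ℂ f g : ℂ).re := by
  rw [L2.inner_def]
  have h1 := integral_re (𝕜 := ℂ) (L2.integrable_inner (𝕜 := ℂ) f g)
  simp only [RCLike.re_eq_complex_re] at h1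
  rw [← h1]
  exact integral_nonneg_of_ae h

/-- A packet times a continuous function is square integrable. -/
theorem memLp_mul_packet {v : Space n → ℝ} (hv : Continuous v) (ε : ℝ) (q : Profile) (τ : ℝ) :
    MemLp (fun x => ((v x : ℝ) : ℂ) * packet n ε q τ x) 2 volume := by
  refine Continuous.memLp_of_hasCompactSupport
    ((Complex.continuous_ofReal.comp hv).mul (SchwartzMap.continuous _)) ?_
  refine HasCompactSupport.intro (isCompact_closedBall (0 : Space n) (2 * |τ|)) fun x hx => ?_
  by_contra h
  exact hx (mem_closedBall_zero_iff.2 (packet_support (right_ne_zero_of_mul h)).2)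

theorem norm_mul_packet_le {v : Space n → ℝ} (hv : Continuous v) (ε : ℝ) (q : Profile) {τ b : ℝ}
    (hb : ∀ x, |τ| ≤ ‖x‖ → ‖x‖ ≤ 2 * |τ| → |v x| ≤ b) :
    ‖(memLp_mul_packet hv ε q τ).toLp _‖ ≤ b * ‖(packet n ε q τ).toLp 2 volume‖ := by
  refine Lp.norm_le_mul_norm_of_ae_le_mul ?_
  filter_upwards [(memLp_mul_packet hv ε q τ).coeFn_toLp,
    SchwartzMap.coeFn_toLp (packet n ε q τ) 2 volume] with x h1 h2
  rw [h1, h2, norm_mul, Complex.norm_real]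
  by_cases h0 : packet n ε q τ x = 0
  · simp [h0]
  · obtain ⟨h3, h4⟩ := packet_support h0
    exact mul_le_mul_of_nonneg_right (hb x h3 h4) (norm_nonneg _)

/-- The integrand of `⟨(v - a)P, P⟩` is `(v - a)|P|²`, so positivity of `v - a` is needed only on
the annulus carrying the packet. -/
theorem le_re_inner_mul_packet {v : Space n → ℝ} (hv : Continuous v) (ε : ℝ) (q : Profile)
    {τ a : ℝ} (ha : ∀ x, |τ| ≤ ‖x‖ → ‖x‖ ≤ 2 * |τ| → a ≤ v x) :
    a * ‖(packet n ε q τ).toLp 2 volume‖ ^ 2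
      ≤ (inner ℂ ((memLp_mul_packet hv ε q τ).toLp _) ((packet n ε q τ).toLp 2 volume) : ℂ).re := by
  set P := (packet n ε q τ).toLp 2 volume
  set u := (memLp_mul_packet hv ε q τ).toLp _
  have h : 0 ≤ (inner ℂ (u - (a : ℂ) • P) P : ℂ).re := by
    refine re_inner_nonneg_of_ae ?_
    filter_upwards [(memLp_mul_packet hv ε q τ).coeFn_toLp,
      SchwartzMap.coeFn_toLp (packet n ε q τ) 2 volume, Lp.coeFn_sub u ((a : ℂ) • P),
      Lp.coeFn_smul (a : ℂ) P] with x h1 h2 h3 h4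
    rw [h3, Pi.sub_apply, h4, Pi.smul_apply, h1, h2, smul_eq_mul, ← sub_mul, ← Complex.ofReal_sub,
      ← smul_eq_mul, inner_smul_left, Complex.conj_ofReal, inner_self_eq_norm_sq_to_K]
    simp only [Complex.coe_algebraMap]
    rw [← Complex.ofReal_pow, ← Complex.ofReal_mul, Complex.ofReal_re]
    by_cases h0 : packet n ε q τ x = 0
    · simp [h0]
    · obtain ⟨h5, h6⟩ := packet_support h0
      exact mul_nonneg (sub_nonneg.2 (ha x h5 h6)) (sq_nonneg _)
  rw [inner_sub_left, inner_smul_left, Complex.conj_ofReal, inner_self_eq_norm_sq_to_K] at h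
  simp only [Complex.coe_algebraMap] at h
  rw [← Complex.ofReal_pow, ← Complex.ofReal_mul, Complex.sub_re, Complex.ofReal_re] at h
  linarith

/-! ### Nonexistence for both signs of time -/

/-- Nonexistence of the wave operator for positive times, with a sign `ε` in the evolution equations
that accounts for time reversal. -/
theorem not_exists_tendsto_of_isLongRange (hn : 1 ≤ n) {m l ε : ℝ} (hm : 0 < m) (hl : l < 1 / 2)
    (hε : ε ^ 2 = 1) {V : ℝ → Space n → ℝ} (hV : IsLongRange l V) {A₀ A : ℝ → L2 n →L[ℂ] L2 n}
    (hA₀u : ∀ t, 0 < t → A₀ t ∈ unitary (L2 n →L[ℂ] L2 n))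
    (hAu : ∀ t, 0 < t → A t ∈ unitary (L2 n →L[ℂ] L2 n))
    (hA₀c : ∀ t, 0 < t → ∀ φ, ContinuousAt (fun τ => A₀ τ φ) t)
    (hAc : ∀ t, 0 < t → ∀ φ, ContinuousAt (fun τ => A τ φ) t)
    (hA₀d : ∀ t, 0 < t → ∀ (ψ : 𝓢(Space n, ℂ)) φ,
      HasDerivAt (fun τ => inner ℂ (ψ.toLp 2 volume) (A₀ τ φ))
        (-(Complex.I * ε) *
          ∫ x, conj (reducedFreeHamiltonian m l t ψ x) * (A₀ t φ : Space n → ℂ) x) t)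
    (hAd : ∀ t, 0 < t → ∀ (ψ : 𝓢(Space n, ℂ)) φ,
      HasDerivAt (fun τ => inner ℂ (ψ.toLp 2 volume) (A τ φ))
        (-(Complex.I * ε) *
          ∫ x, conj (reducedHamiltonian m l V t ψ x) * (A t φ : Space n → ℂ) x) t) :
    ¬ ∃ W : L2 n →L[ℂ] L2 n,
      ∀ φ, Tendsto (fun t => ContinuousLinearMap.adjoint (A t) (A₀ t φ)) atTop (𝓝 (W φ)) := by
  obtain ⟨T, a, b, σ, hT, ha, hb, hσ, hVb⟩ := hV.exists_bounds hm hl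
  have hT0 : 0 < T := by linarith
  set q := Profile.bump
  set N := ‖(packet n ε q 1).toLp 2 volume‖
  have hN : 0 < N := norm_toLp_packet_bump_pos hn ε
  have hVc : ∀ t, Continuous fun x : Space n => V t (|t| ^ l • x) := fun t =>
    hV.1.comp (continuous_const.prodMk (continuous_const_smul _))
  have hconj : conj (Complex.I * (ε : ℂ)) = -(Complex.I * ε) := by simp
  have hcurve : ∀ t, 0 < t → HasDerivAt (fun s => (packet n ε q (freeTime m l s)).toLp 2 volume)
      ((((t ^ (-(2 * l)) / m : ℝ) : ℂ) • packetDeriv n ε q (freeTime m l t)).toLp 2 volume) t := by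
    intro t ht
    have h := (hasDerivAt_toLp_packet (n := n) ε q (freeTime_pos hm hl ht)).scomp t
      (hasDerivAt_freeTime hm hl ht)
    rw [toLp_smul, Complex.coe_smul]
    exact h
  have hdefect : ∀ t, 0 < t → ∀ y : L2 n,
      (inner ℂ ((((t ^ (-(2 * l)) / m : ℝ) : ℂ) • packetDeriv n ε q (freeTime m l t)).toLp 2 volume)
        y : ℂ) + -(Complex.I * ε) * inner ℂ
          ((freeHamiltonianSchwartz m l t (packet n ε q (freeTime m l t))).toLp 2 volume) y
      = inner ℂ ((freeDefect n m l ε q t).toLp 2 volume) y := by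
    intro t ht y
    rw [← freeDefect_eq hm hl hε ht, toLp_add, toLp_smul (Complex.I * ε), inner_add_left,
      inner_smul_left (r := Complex.I * ε), hconj]
  have habs : ∀ t, 0 < t → |freeTime m l t| = freeTime m l t := fun t ht =>
    abs_of_pos (freeTime_pos hm hl ht)
  -- The packet has constant norm `N`, so `a ≤ V t ^ σ ≤ b` on its support yields `C₁ = a N²` and
  -- `C₂ = b N` with the same weight `w`. Antilinearity in the first slot makes `μ` equal to `-iε`.
  refine not_tendsto_adjoint_comp (T := T) (B := m * (1 - 2 * l) ^ 2 *
      ‖(packet n ε (q.defect n ε) 1).toLp 2 volume‖) (p := 2 - 2 * l) (c := N) (C₁ := a * N ^ 2)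
    (C₂ := b * N) (Ψ := fun t => (packet n ε q (freeTime m l t)).toLp 2 volume)
    (e := fun t => (freeDefect n m l ε q t).toLp 2 volume)
    (v := fun t => (memLp_mul_packet (hVc t) ε q (freeTime m l t)).toLp _)
    (w := fun t => t ^ (-σ)) (μ := -(Complex.I * ε)) hT0 (by linarith) (by positivity)
    (by positivity) (by positivity) hA₀u hAu ?_ ?_ ?_ ?_ ?_ ?_ ?_ ?_
  · rw [norm_neg, norm_mul, Complex.norm_I, one_mul, Complex.norm_real, Real.norm_eq_abs, ← abs_one]
    exact (sq_eq_sq_iff_abs_eq_abs _ _).1 (by rw [hε, one_pow])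
  · intro t ht η
    have ht0 := hT0.trans_le ht
    have h := hasDerivAt_inner_of_weak (hcurve t ht0) (hA₀c t ht0 η) (hA₀d t ht0 _ η)
    rw [← freeHamiltonianSchwartz_coe, integral_conj_mul_eq_inner
      ((freeHamiltonianSchwartz m l t _).memLp 2 volume)] at h
    exact h.congr_deriv (hdefect t ht0 _)
  · intro t ht η
    have ht0 := hT0.trans_le ht
    have h := hasDerivAt_inner_of_weak (hcurve t ht0) (hAc t ht0 η) (hAd t ht0 _ η)
    have hH : reducedHamiltonian m l V t (packet n ε q (freeTime m l t))
        = ⇑(freeHamiltonianSchwartz m l t (packet n ε q (freeTime m l t)))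
          + fun x => ((V t (|t| ^ l • x) : ℝ) : ℂ) * packet n ε q (freeTime m l t) x := rfl
    have h1 := (freeHamiltonianSchwartz m l t (packet n ε q (freeTime m l t))).memLp 2 volume
    have h2 := memLp_mul_packet (hVc t) ε q (freeTime m l t)
    rw [hH, integral_conj_mul_eq_inner (h1.add h2), MemLp.toLp_add h1 h2, inner_add_left, mul_add,
      ← add_assoc] at h
    exact h.congr_deriv (congrArg₂ (· + ·) (hdefect t ht0 _) rfl)
  · intro t ht
    exact (norm_freeDefect hm hl (hT0.trans_le ht) q).le
  · intro t ht
    exact (norm_toLp_packet ε q (freeTime_pos hm hl (hT0.trans_le ht))).le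
  · intro t ht
    rw [← Real.rpow_neg_one]
    exact Real.rpow_le_rpow_of_exponent_le (hT.trans ht) (by linarith)
  · intro t ht
    have ht0 := hT0.trans_le ht
    refine (norm_mul_packet_le (hVc t) ε q (b := b * t ^ (-σ)) fun x h1 h2 => ?_).trans ?_
    · rw [habs t ht0] at h1 h2
      obtain ⟨h3, h4⟩ := hVb t ht x h1 h2
      rwa [abs_of_nonneg (le_trans (by positivity) h3)]
    · rw [norm_toLp_packet ε q (freeTime_pos hm hl ht0)]
      exact le_of_eq (by ring)
  · intro t ht
    have ht0 := hT0.trans_le ht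
    refine le_trans ?_ (le_re_inner_mul_packet (hVc t) ε q (a := a * t ^ (-σ)) fun x h1 h2 => ?_)
    · rw [norm_toLp_packet ε q (freeTime_pos hm hl ht0)]
      exact le_of_eq (by ring)
    · rw [habs t ht0] at h1 h2
      exact (hVb t ht x h1 h2).1

theorem IsLongRange.comp_neg {l : ℝ} {V : ℝ → Space n → ℝ} (hV : IsLongRange l V) :
    IsLongRange l fun t => V (-t) := by
  obtain ⟨hc, ρ, C, C', h1, h2, h3, h4, h5⟩ := hV
  exact ⟨hc.comp (continuous_fst.neg.prodMk continuous_snd), ρ, C, C', h1, h2, h3, h4,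
    fun t => h5 (-t)⟩

theorem IsPropagatorOn.continuousAt {J : Set ℝ} {H : ℝ → 𝓢(Space n, ℂ) → Space n → ℂ}
    {U : ℝ → ℝ → L2 n →L[ℂ] L2 n} (hU : IsPropagatorOn J H U) (hJ : IsOpen J) {t s : ℝ}
    (ht : t ∈ J) (hs : s ∈ J) (φ : L2 n) : ContinuousAt (fun τ => U τ s φ) t :=
  ContinuousAt.comp (f := fun τ : ℝ => (τ, s)) (g := fun q : ℝ × ℝ => U q.1 q.2 φ)
    ((hU.strongly_continuous φ).continuousAt ((hJ.prod hJ).mem_nhds ⟨ht, hs⟩))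
    (continuousAt_id.prodMk continuousAt_const)

theorem IsPropagatorOn.hasDerivAt {J : Set ℝ} {H : ℝ → 𝓢(Space n, ℂ) → Space n → ℂ}
    {U : ℝ → ℝ → L2 n →L[ℂ] L2 n} (hU : IsPropagatorOn J H U) (hJ : IsOpen J) {t s : ℝ}
    (ht : t ∈ J) (hs : s ∈ J) (ψ : 𝓢(Space n, ℂ)) (φ : L2 n) :
    HasDerivAt (fun τ => inner ℂ (ψ.toLp 2 volume) (U τ s φ))
      (-Complex.I * ∫ x, conj (H t ψ x) * (U t s φ : Space n → ℂ) x) t :=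
  (hU.evolution s hs t ht ψ φ).hasDerivAt (hJ.mem_nhds ht)

/-- Reflecting time reverses the sign of `i`; this is the evolution equation with `ε = -1`. -/
theorem IsPropagatorOn.hasDerivAt_comp_neg {J : Set ℝ} {H : ℝ → 𝓢(Space n, ℂ) → Space n → ℂ}
    {U : ℝ → ℝ → L2 n →L[ℂ] L2 n} (hU : IsPropagatorOn J H U) (hJ : IsOpen J) {t s : ℝ}
    (ht : -t ∈ J) (hs : s ∈ J) (ψ : 𝓢(Space n, ℂ)) (φ : L2 n) :
    HasDerivAt (fun τ => inner ℂ (ψ.toLp 2 volume) (U (-τ) s φ))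
      (Complex.I * ∫ x, conj (H (-t) ψ x) * (U (-t) s φ : Space n → ℂ) x) t := by
  have h := (hU.hasDerivAt hJ ht hs ψ φ).scomp t (hasDerivAt_neg t)
  refine h.congr_deriv ?_
  simp

end DecayingOscillator

end

theorem theorem2 (n : ℕ) (hn : 1 ≤ n) (m k r₀ : ℝ) (hm : 0 < m) (hk₀ : 0 ≤ k) (hk : k < m / 4)
    (hr₀ : 0 < r₀) (V : ℝ → DecayingOscillator.Space n → ℝ)
    (hV : DecayingOscillator.IsLongRange (DecayingOscillator.lam m k) V)
    (U₀ U : ℝ → ℝ → DecayingOscillator.L2 n →L[ℂ] DecayingOscillator.L2 n)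
    (hU₀_pos : DecayingOscillator.IsPropagatorOn (Set.Ioi 0)
      (DecayingOscillator.reducedFreeHamiltonian m (DecayingOscillator.lam m k)) U₀)
    (hU₀_neg : DecayingOscillator.IsPropagatorOn (Set.Iio 0)
      (DecayingOscillator.reducedFreeHamiltonian m (DecayingOscillator.lam m k)) U₀)
    (hU_pos : DecayingOscillator.IsPropagatorOn (Set.Ioi 0)
      (DecayingOscillator.reducedHamiltonian m (DecayingOscillator.lam m k) V) U)
    (hU_neg : DecayingOscillator.IsPropagatorOn (Set.Iio 0)
      (DecayingOscillator.reducedHamiltonian m (DecayingOscillator.lam m k) V) U) :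
    (¬ ∃ W, DecayingOscillator.IsWaveOperator atTop r₀ U U₀ W) ∧
      (¬ ∃ W, DecayingOscillator.IsWaveOperator atBot (-r₀) U U₀ W) := by
  have hl := DecayingOscillator.lam_lt_half hm hk
  have hr : -r₀ ∈ Set.Iio (0 : ℝ) := neg_lt_zero.2 hr₀
  constructor
  · exact DecayingOscillator.not_exists_tendsto_of_isLongRange hn (ε := 1) hm hl (by norm_num) hV
      (A₀ := fun t => U₀ t r₀) (A := fun t => U t r₀)
      (fun t ht => hU₀_pos.mem_unitary t ht r₀ hr₀) (fun t ht => hU_pos.mem_unitary t ht r₀ hr₀)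
      (fun t ht φ => hU₀_pos.continuousAt isOpen_Ioi ht hr₀ φ)
      (fun t ht φ => hU_pos.continuousAt isOpen_Ioi ht hr₀ φ)
      (fun t ht ψ φ => by simpa using hU₀_pos.hasDerivAt isOpen_Ioi ht hr₀ ψ φ)
      (fun t ht ψ φ => by simpa using hU_pos.hasDerivAt isOpen_Ioi ht hr₀ ψ φ)
  · rintro ⟨W, hW⟩
    -- The kinetic factor and the dilation depend only on `|t|`, so reflection alters nothing in the
    -- Hamiltonians except `V`, which remains long-range.
    refine DecayingOscillator.not_exists_tendsto_of_isLongRange hn (ε := -1) hm hl (by norm_num)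
      hV.comp_neg (A₀ := fun t => U₀ (-t) (-r₀)) (A := fun t => U (-t) (-r₀))
      (fun t ht => hU₀_neg.mem_unitary (-t) (neg_lt_zero.2 ht) (-r₀) hr)
      (fun t ht => hU_neg.mem_unitary (-t) (neg_lt_zero.2 ht) (-r₀) hr)
      (fun t ht φ => ContinuousAt.comp (g := fun τ => U₀ τ (-r₀) φ)
        (hU₀_neg.continuousAt isOpen_Iio (neg_lt_zero.2 ht) hr φ) continuous_neg.continuousAt)
      (fun t ht φ => ContinuousAt.comp (g := fun τ => U τ (-r₀) φ)
        (hU_neg.continuousAt isOpen_Iio (neg_lt_zero.2 ht) hr φ) continuous_neg.continuousAt)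
      (fun t ht ψ φ => ?_) (fun t ht ψ φ => ?_) ⟨W, fun φ => (hW φ).comp tendsto_neg_atTop_atBot⟩
    · simpa [DecayingOscillator.reducedFreeHamiltonian] using
        hU₀_neg.hasDerivAt_comp_neg isOpen_Iio (neg_lt_zero.2 ht) hr ψ φ
    · simpa [DecayingOscillator.reducedHamiltonian] using
        hU_neg.hasDerivAt_comp_neg isOpen_Iio (neg_lt_zero.2 ht) hr ψ φ
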